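/- A semigroup is aperiodic if all of its subgroups are trivial. For a finite monoid $T$, an element $t\in T$ is aperiodic if $t^{\omega}=t^{\omega+1}$, where $t^{\omega}$ is the idempotent positive power of $t$. A relational morphism $\varphi\colon S\to T$ of monoids is a submonoid of $S\times T$ projecting onto $S$; write $s\varphi=\{t\in T\mid (s,t)\in\varphi\}$ and $B\varphi^{-1}=\{s\in S\mid s\varphi\cap B\neq\emptyset\}$ for $B\subseteq T$. Let $S$ be a monoid. A submonoid $S'$ of $S$ is of Type I if, for every relational morphism $\varphi\colon S\to T$ with $T$ a finite aperiodic monoid, there is a submonoid $T'\le T$ whose idempotents generate an $\mathscr R$-trivial semigroup and such that $S'\subseteq T'\varphi^{-1}$. Let $\mathsf K_{\mathbf G}(S)$ be the submonoid of Type II elements of $S$, that is, of those $s\in S$ such that $1\in s\varphi$ for every relational morphism $\varphi\colon S\to G$ with $G$ a finite group. The $n$-loopable elements of a monoid are defined recursively: every element of $S$ is $0$-loopable; for $n\ge 1$, $s\in S$ is $n$-loopable in $S$ if there is a Type I submonoid $T$ of $S$ such that $s$ is an $(n-1)$-loopable element of $\mathsf K_{\mathbf G}(T)$. The (group) complexity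 of a finite monoid $T$ is the least $m\ge 0$ such that $T$ divides (is a homomorphic image of a subsemigroup of) a wreath product $A_m\wr G_m\wr A_{m-1}\wr\cdots\wr A_1\wr G_1\wr A_0$, bracketed from the left, with finite aperiodic semigroups $A_i$ and finite groups $G_i$; here $P\wr Q=P^{Q^1}\rtimes Q$. Let $\mathbf C_n$ be the class of finite monoids of complexity at most $n$. An element $s\in S$ is $\mathbf C_n$-aperiodic if, for every relational morphism $\varphi\colon S\to T$ with $T\in\mathbf C_n$, there is an aperiodic element $t\in T$ with $t\in s\varphi$. **Proposition.** Let $S$ be a monoid and let $n\ge 0$. If $s\in S$ is $n$-loopable, then $s$ is $\mathbf C_n$-aperiodic. -/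

import Mathlib

universe u

namespace KrohnRhodes

/-! ## Aperiodic semigroups and `R`-trivial semigroups -/

/-- A subsemigroup `H` of a semigroup `S` is a *subgroup* of `S` if it is a group under the
multiplication of `S` (its identity element need not be an identity of `S`). -/
def IsSubgroupOf {S : Type u} [Semigroup S] (H : Subsemigroup S) : Prop :=
  ∃ e ∈ H, ∀ x ∈ H, e * x = x ∧ x * e = x ∧ ∃ y ∈ H, x * y = e ∧ y * x = e

/-- A semigroup is *aperiodic* if all of its subgroups are trivial. -/
def IsAperiodicSemigroup (S : Type u) [Semigroup S] : Prop :=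
  ∀ H : Subsemigroup S, IsSubgroupOf H → ∀ x ∈ H, ∀ y ∈ H, x = y

/-- An element `t` of a finite monoid is *aperiodic* if `t ^ ω = t ^ (ω + 1)`, where `t ^ ω` is the
idempotent among the powers of `t` with positive exponent. -/
def IsAperiodicElement {T : Type u} [Monoid T] (t : T) : Prop :=
  ∃ k : ℕ, 0 < k ∧ IsIdempotentElem (t ^ k) ∧ t ^ k = t ^ (k + 1)

/-- A semigroup is *`R`-trivial* if Green's relation `R` is equality on it: elements that
generate the same principal right ideal are equal. (Two distinct elements `a`, `b` satisfy
`a S¹ = b S¹` exactly when `b ∈ a S` and `a ∈ b S`.) -/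
def IsRTrivial (S : Type u) [Semigroup S] : Prop :=
  ∀ a b x y : S, a * x = b → b * y = a → a = b

/-- `M` belongs to `ER`: its idempotents generate an `R`-trivial semigroup. -/
def IsER (M : Type u) [Semigroup M] : Prop :=
  IsRTrivial (Subsemigroup.closure {e : M | IsIdempotentElem e})

/-! ## Wreath products, division and group complexity -/

/-- The semigroup `T` has a two-sided identity element. -/
def HasIdentity (T : Type u) [Semigroup T] : Prop :=
  ∃ e : T, ∀ t : T, e * t = t ∧ t * e = t

/-- The set `T¹`: it is `T` if `T` has an identity element, and `T` with an identity element
adjoined otherwise. It is realised inside `WithOne T`, the semigroup `T` with a new identity `1`: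
the new identity is kept only if `T` has no identity of its own. -/
def OneAdjoined (T : Type u) [Semigroup T] : Type u :=
  {x : WithOne T // x = 1 → ¬ HasIdentity T}

theorem mul_coe_ne_one {T : Type u} [Semigroup T] (x : WithOne T) (t : T) :
    x * (t : WithOne T) ≠ 1 := by
  induction x with
  | one => simp
  | coe a => rw [← WithOne.coe_mul]; exact WithOne.coe_ne_one

/-- The right action of `T` on `T¹` by multiplication. -/
def OneAdjoined.act {T : Type u} [Semigroup T] (x : OneAdjoined T) (t : T) : OneAdjoined T :=
  ⟨x.1 * (t : WithOne T), fun h => absurd h (mul_coe_ne_one x.1 t)⟩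

theorem OneAdjoined.act_mul {T : Type u} [Semigroup T] (x : OneAdjoined T) (s t : T) :
    x.act (s * t) = (x.act s).act t := by
  apply Subtype.ext
  simp only [OneAdjoined.act, WithOne.coe_mul, mul_assoc]

/-- The wreath product `S ≀ T` of two semigroups, that is, the semidirect product
`S ^ (T¹) ⋊ T` for the left action of `T` on functions `T¹ → S` given by `(t • g) x = g (x t)`. -/
@[ext]
structure Wreath (S T : Type u) [Semigroup S] [Semigroup T] : Type u where
  left : OneAdjoined T → S
  right : T

instance (S T : Type u) [Semigroup S] [Semigroup T] : Semigroup (Wreath S T) where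
  mul p q := ⟨fun x => p.left x * q.left (x.act p.right), p.right * q.right⟩
  mul_assoc p q r := by
    apply Wreath.ext
    · funext x
      change p.left x * q.left (x.act p.right) * r.left (x.act (p.right * q.right)) =
        p.left x * (q.left (x.act p.right) * r.left ((x.act p.right).act q.right))
      rw [OneAdjoined.act_mul, mul_assoc]
    · exact mul_assoc p.right q.right r.right

/-- `S` *divides* `W` (written `S ≺ W`): `S` is a homomorphic image of a subsemigroup of `W`. -/
def Divides (S W : Type u) [Semigroup S] [Semigroup W] : Prop :=
  ∃ (K : Subsemigroup W) (f : K →ₙ* S), Function.Surjective f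

/-- `IteratedWreath n W` says that `W` is a wreath product
`A_n ≀ G_n ≀ A_{n-1} ≀ ⋯ ≀ A_1 ≀ G_1 ≀ A_0` (bracketed to the left) in which the `A_i` are finite
aperiodic semigroups and the `G_i` are finite groups. -/
inductive IteratedWreath : ℕ → (W : Type u) → Semigroup W → Prop
  | base (A : Type u) [sA : Semigroup A] [Finite A] (hA : IsAperiodicSemigroup A) :
      IteratedWreath 0 A sA
  | step {n : ℕ} {W : Type u} [sW : Semigroup W] (hW : IteratedWreath n W sW)
      (G : Type u) [Group G] [Finite G]
      (A : Type u) [Semigroup A] [Finite A] (hA : IsAperiodicSemigroup A) :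
      IteratedWreath (n + 1) (Wreath (Wreath W G) A) inferInstance

/-- Membership in `C_n`, the class of finite monoids of group complexity at most `n`. The group
complexity of `T` is the least `m` such that `T` divides a wreath product
`A_m ≀ G_m ≀ A_{m-1} ≀ ⋯ ≀ A_1 ≀ G_1 ≀ A_0` with aperiodic `A_i` and groups `G_i`. -/
def ComplexityLE (n : ℕ) (T : Type u) [Monoid T] : Prop :=
  Finite T ∧ ∃ m ≤ n, ∃ (W : Type u) (sW : Semigroup W), IteratedWreath m W sW ∧ Divides T W

/-! ## Relational morphisms, Type I and Type II, loopable elements -/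

/-- A *relational morphism* of monoids `S → T`: a submonoid of `S × T` that projects onto `S`. -/
structure RelMorphism (S T : Type u) [Monoid S] [Monoid T] where
  graph : Submonoid (S × T)
  total : ∀ s : S, ∃ t : T, (s, t) ∈ graph

/-- `φ.Rel s t` says that `t ∈ s φ`, equivalently `s ∈ t φ⁻¹`. -/
def RelMorphism.Rel {S T : Type u} [Monoid S] [Monoid T] (φ : RelMorphism S T) (s : S) (t : T) :
    Prop :=
  (s, t) ∈ φ.graph

/-- A submonoid `S'` of `S` is *Type I* if for every relational morphism `φ` from `S` to a finite
aperiodic monoid `T` there is a submonoid `T'` of `T` in `ER` with `S' ⊆ T' φ⁻¹`. -/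
def IsTypeI {S : Type u} [Monoid S] (S' : Submonoid S) : Prop :=
  ∀ (T : Type u) [Monoid T] [Finite T], IsAperiodicSemigroup T → ∀ φ : RelMorphism S T,
    ∃ T' : Submonoid T, IsER T' ∧ ∀ s ∈ S', ∃ t ∈ T', φ.Rel s t

/-- The submonoid of *Type II* elements of `S`: the elements that are related to `1` under every
relational morphism from `S` to a finite group. -/
def typeII (S : Type u) [Monoid S] : Submonoid S where
  carrier := {s | ∀ (G : Type u) [Group G] [Finite G] (φ : RelMorphism S G), φ.Rel s 1}
  one_mem' := fun _ _ _ φ => φ.graph.one_mem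
  mul_mem' := fun {a b} ha hb G _ _ φ => by
    have h := φ.graph.mul_mem (ha G φ) (hb G φ)
    rwa [Prod.mk_mul_mk, mul_one] at h

/-- The *`n`-loopable* elements of a monoid. Every element is `0`-loopable, and `s` is
`(n + 1)`-loopable in `S` if there is a Type I submonoid `T` of `S` such that `s` is an `n`-loopable
element of the submonoid of Type II elements of `T`. -/
def IsLoopable : ℕ → (S : Type u) → [Monoid S] → S → Prop
  | 0, _, _, _ => True
  | n + 1, S, _, s => ∃ T : Submonoid S, IsTypeI T ∧
      ∃ k : typeII T, ((k : T) : S) = s ∧ IsLoopable n (typeII T) k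

/-- An element `s` of `S` is *`C_n`-aperiodic* if every relational morphism from `S` to a finite
monoid of complexity at most `n` relates `s` to an aperiodic element. -/
def IsComplexityAperiodic (n : ℕ) {S : Type u} [Monoid S] (s : S) : Prop :=
  ∀ (T : Type u) [Monoid T], ComplexityLE n T → ∀ φ : RelMorphism S T,
    ∃ t : T, IsAperiodicElement t ∧ φ.Rel s t

end KrohnRhodes

namespace KrohnRhodes

/-! ## Aperiodic elements and monoids -/

/-! A monoid of complexity at most `n` is replaced by one embedded in unitary semidirect products
(`CascadeLE`), and the claim is proved there by induction on `n`. At level `n + 1` the target embeds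
in `P ^ X ⋊ (G ^ Y ⋊ A)`. Let `T` be the Type I submonoid witnessing loopability. Projecting to `A`
gives a submonoid `A'` in `ER` that covers `T`, and its preimage `N` in `G ^ Y ⋊ A` has at most one
idempotent in each `R`-class (`Cascade.uniqueRIdempotents`). Hence right multiplications are partial
injections on the regular `R`-classes of `N`. Extending them to permutations relates `N` to a finite
group so that the preimage `B` of `1` is aperiodic. Type II elements of `T` relate to `1` in that
group, so they are related to elements of `P ^ X ⋊ B`. As `B` is aperiodic, this product is still at
level `n` (`CascadeLE.cascade`), and induction applies. -/

/-- Every element `m` of the monoid satisfies `m ^ (k + 1) = m ^ k` for some `k`. -/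
def PowersStabilize (M : Type u) [Monoid M] : Prop :=
  ∀ m : M, ∃ k : ℕ, m ^ (k + 1) = m ^ k

theorem pow_add_eq_of_pow_succ_eq {M : Type u} [Monoid M] {m : M} {k : ℕ}
    (h : m ^ (k + 1) = m ^ k) (j : ℕ) : m ^ (k + j) = m ^ k := by
  induction j with
  | zero => rfl
  | succ j ih => rw [← add_assoc, pow_succ, ih, ← pow_succ, h]

theorem isAperiodicElement_iff {M : Type u} [Monoid M] {m : M} :
    IsAperiodicElement m ↔ ∃ k : ℕ, m ^ (k + 1) = m ^ k := by
  constructor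
  · rintro ⟨k, -, -, h⟩
    exact ⟨k, h.symm⟩
  · rintro ⟨k, h⟩
    have h' := pow_add_eq_of_pow_succ_eq h
    refine ⟨k + 1, Nat.succ_pos k, ?_, ?_⟩
    · change m ^ (k + 1) * m ^ (k + 1) = m ^ (k + 1)
      rw [← pow_add, add_assoc, h', h]
    · rw [add_assoc, h', h']

theorem PowersStabilize.exists_uniform {M : Type u} [Monoid M] [Finite M]
    (h : PowersStabilize M) : ∃ k : ℕ, ∀ m : M, m ^ (k + 1) = m ^ k := by
  choose κ hκ using h
  obtain ⟨k, hk⟩ := (Set.finite_range κ).bddAbove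
  refine ⟨k, fun m => ?_⟩
  obtain ⟨j, rfl⟩ := Nat.exists_eq_add_of_le (hk ⟨m, rfl⟩)
  rw [add_assoc, pow_add_eq_of_pow_succ_eq (hκ m), pow_add_eq_of_pow_succ_eq (hκ m)]

theorem PowersStabilize.of_injective {M N : Type u} [Monoid M] [Monoid N] (h : PowersStabilize N)
    (f : M →* N) (hf : Function.Injective f) : PowersStabilize M := fun m => by
  obtain ⟨k, hk⟩ := h (f m)
  exact ⟨k, hf (by simpa only [map_pow] using hk)⟩

theorem PowersStabilize.isAperiodicSemigroup {M : Type u} [Monoid M] (h : PowersStabilize M) :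
    IsAperiodicSemigroup M := by
  rintro H ⟨e, he, hH⟩
  suffices hx : ∀ x ∈ H, x = e from fun x hx' y hy' => (hx x hx').trans (hx y hy').symm
  intro x hx
  obtain ⟨hex, -, y, hy, -, hyx⟩ := hH x hx
  have key : ∀ k : ℕ, e * x ^ (k + 1) = e * x ^ k → x = e := by
    intro k
    induction k with
    | zero => intro h0; simpa [hex] using h0
    | succ k ih =>
      intro hk
      apply ih
      have hk' := congrArg (y * ·) hk
      have hcancel : ∀ j : ℕ, y * x ^ (j + 1) = e * x ^ j := fun j => by
        rw [pow_succ', ← mul_assoc, hyx]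
      simpa only [← mul_assoc, (hH y hy).2.1, hcancel] using hk'
  obtain ⟨k, hk⟩ := h x
  exact key k (by rw [hk])

theorem exists_period {M : Type u} [Monoid M] [Finite M] (a : M) :
    ∃ k : ℕ, 0 < k ∧ ∀ j c : ℕ, k ≤ j → a ^ (j + k * c) = a ^ j := by
  obtain ⟨i, p, hp, hip⟩ : ∃ i p : ℕ, 0 < p ∧ a ^ (i + p) = a ^ i := by
    obtain ⟨i, j, hij, h⟩ := Finite.exists_ne_map_eq_of_infinite (fun j : ℕ => a ^ j)
    rcases lt_or_gt_of_ne hij with hlt | hlt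
    · exact ⟨i, j - i, Nat.sub_pos_of_lt hlt, by rw [Nat.add_sub_cancel' hlt.le]; exact h.symm⟩
    · exact ⟨j, i - j, Nat.sub_pos_of_lt hlt, by rw [Nat.add_sub_cancel' hlt.le]; exact h⟩
  have hper : ∀ j c : ℕ, i ≤ j → a ^ (j + p * c) = a ^ j := by
    intro j c hj
    obtain ⟨d, rfl⟩ := Nat.exists_eq_add_of_le hj
    induction c with
    | zero => simp
    | succ c ih =>
      rw [← ih, show i + d + p * (c + 1) = i + p + (d + p * c) by ring, pow_add, hip, ← pow_add,
        ← add_assoc]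
  -- A positive multiple of the period that is at least the preperiod `i`: one number serves as
  -- both.
  refine ⟨p * (i + 1), by positivity, fun j c hj => ?_⟩
  rw [mul_assoc]
  exact hper j _ (le_trans (by nlinarith) hj)

/-- The powers of `a` with exponent at least `k` form a group with identity `a ^ k`. It is trivial,
so it identifies `a ^ (k + 1)` with `a ^ k`. -/
theorem IsAperiodicSemigroup.exists_pow_succ_eq {A : Type u} [Semigroup A] [Finite A]
    (hA : IsAperiodicSemigroup A) (a : A) :
    ∃ k : ℕ, (a : WithOne A) ^ (k + 1) = (a : WithOne A) ^ k := by
  have hcoe : ∀ j : ℕ, 0 < j → ∃ x : A, (x : WithOne A) = (a : WithOne A) ^ j := by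
    intro j hj
    induction j, hj using Nat.le_induction with
    | base => exact ⟨a, (pow_one _).symm⟩
    | succ j _ ih =>
      obtain ⟨x, hx⟩ := ih
      exact ⟨x * a, by rw [WithOne.coe_mul, hx, pow_succ]⟩
  have : Finite (WithOne A) := inferInstanceAs (Finite (Option A))
  obtain ⟨k, hk0, hperk⟩ := exists_period (a : WithOne A)
  let H : Subsemigroup A :=
    { carrier := {x | ∃ j, k ≤ j ∧ (x : WithOne A) = (a : WithOne A) ^ j}
      mul_mem' := by
        rintro x y ⟨j, hj, hx⟩ ⟨l, -, hy⟩
        exact ⟨j + l, hj.trans (Nat.le_add_right j l), by rw [WithOne.coe_mul, hx, hy, pow_add]⟩ }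
  obtain ⟨e, he⟩ := hcoe k hk0
  obtain ⟨x, hx⟩ := hcoe (k + 1) (Nat.succ_pos k)
  have hH : IsSubgroupOf H := by
    refine ⟨e, ⟨k, le_rfl, he⟩, ?_⟩
    rintro y ⟨j, hj, hy⟩
    have hmul := hperk j 1 hj
    rw [mul_one] at hmul
    -- The inverse of `a ^ j` is `a ^ (j * (2 * k - 1))`; the factor `k - 1` would vanish for `k =
    -- 1`.
    have hle : j ≤ j * (2 * k - 1) := Nat.le_mul_of_pos_right j (by omega)
    have hsum : j + j * (2 * k - 1) = k + k * (2 * j - 1) := by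
      obtain ⟨k', hk'⟩ := Nat.exists_eq_add_of_lt hk0
      obtain ⟨j', hj'⟩ := Nat.exists_eq_add_of_lt (hk0.trans_le hj)
      rw [hk', hj', show 2 * (0 + k' + 1) - 1 = 2 * k' + 1 by omega,
        show 2 * (0 + j' + 1) - 1 = 2 * j' + 1 by omega]
      ring
    obtain ⟨z, hz⟩ := hcoe (j * (2 * k - 1)) ((hk0.trans_le hj).trans_le hle)
    refine ⟨?_, ?_, z, ⟨_, hj.trans hle, hz⟩, ?_, ?_⟩ <;> apply WithOne.coe_injective <;>
      rw [WithOne.coe_mul]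
    · rw [he, hy, ← pow_add, add_comm, hmul]
    · rw [he, hy, ← pow_add, hmul]
    · rw [he, hy, hz, ← pow_add, hsum, hperk k _ le_rfl]
    · rw [he, hy, hz, ← pow_add, add_comm, hsum, hperk k _ le_rfl]
  refine ⟨k, ?_⟩
  rw [← hx, ← he, hA H hH x ⟨k + 1, Nat.le_succ k, hx⟩ e ⟨k, le_rfl, he⟩]

theorem IsAperiodicSemigroup.powersStabilize_withOne {A : Type u} [Semigroup A] [Finite A]
    (hA : IsAperiodicSemigroup A) : PowersStabilize (WithOne A) := by
  intro a
  induction a with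
  | one => exact ⟨0, by simp⟩
  | coe a => exact hA.exists_pow_succ_eq a

/-! ## Unitary semidirect products of function monoids -/

/-- A right action of a monoid `N` on a set `X`. -/
structure RightAction (N X : Type u) [Monoid N] where
  act : X → N → X
  act_one : ∀ x, act x 1 = x
  act_mul : ∀ x m n, act x (m * n) = act (act x m) n

/-- The semidirect product `P ^ X ⋊ N` defined by a right action of `N` on `X`. -/
@[ext]
structure Cascade (P : Type u) {N X : Type u} [Monoid N] (ρ : RightAction N X) : Type u where
  left : X → P
  right : N

namespace Cascade

variable {P N X : Type u} [Monoid P] [Monoid N] {ρ : RightAction N X}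

instance : Monoid (Cascade P ρ) where
  mul c d := ⟨fun x => c.left x * d.left (ρ.act x c.right), c.right * d.right⟩
  one := ⟨fun _ => 1, 1⟩
  mul_assoc c d e := by
    apply Cascade.ext
    · funext x
      change c.left x * d.left (ρ.act x c.right) * e.left (ρ.act x (c.right * d.right)) =
        c.left x * (d.left (ρ.act x c.right) * e.left (ρ.act (ρ.act x c.right) d.right))
      rw [ρ.act_mul, mul_assoc]
    · exact mul_assoc c.right d.right e.right
  one_mul c := by
    apply Cascade.ext
    · funext x
      change 1 * c.left (ρ.act x 1) = c.left x
      rw [ρ.act_one, one_mul]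
    · exact one_mul c.right
  mul_one c := by
    apply Cascade.ext
    · funext x
      exact mul_one (c.left x)
    · exact mul_one c.right

@[simp] theorem mul_left (c d : Cascade P ρ) (x : X) :
    (c * d).left x = c.left x * d.left (ρ.act x c.right) := rfl

@[simp] theorem mul_right (c d : Cascade P ρ) : (c * d).right = c.right * d.right := rfl

@[simp] theorem one_left (x : X) : (1 : Cascade P ρ).left x = 1 := rfl

@[simp] theorem one_right : (1 : Cascade P ρ).right = 1 := rfl

/-- The projection of `P ^ X ⋊ N` onto `N`. -/
def rightHom (P : Type u) [Monoid P] (ρ : RightAction N X) : Cascade P ρ →* N where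
  toFun := Cascade.right
  map_one' := rfl
  map_mul' _ _ := rfl

instance [Finite P] [Finite N] [Finite X] : Finite (Cascade P ρ) :=
  Finite.of_injective (fun c : Cascade P ρ => (c.left, c.right)) fun _ _ h =>
    Cascade.ext (congrArg Prod.fst h) (congrArg Prod.snd h)

theorem pow_right (c : Cascade P ρ) (k : ℕ) : (c ^ k).right = c.right ^ k :=
  map_pow (rightHom P ρ) c k

theorem pow_left_of_act_eq (c : Cascade P ρ) {x : X} (hx : ρ.act x c.right = x) (j : ℕ) :
    (c ^ j).left x = c.left x ^ j := by
  induction j with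
  | zero => simp
  | succ j ih => rw [pow_succ', mul_left, hx, ih, ← pow_succ']

/-- Once `c.right ^ k` is stable, every point it reaches is fixed by `c.right`, so the further left
factors are powers of one element of `P`. Finiteness gives an exponent that works at all points. -/
theorem powersStabilize [Finite P] (hP : PowersStabilize P) (hN : PowersStabilize N) :
    PowersStabilize (Cascade P ρ) := by
  intro c
  obtain ⟨j, hj⟩ := hP.exists_uniform
  obtain ⟨k, hk⟩ := hN c.right
  have hfix : ∀ x, ρ.act (ρ.act x (c ^ k).right) c.right = ρ.act x (c ^ k).right := by
    intro x
    rw [← ρ.act_mul, pow_right, ← pow_succ, hk]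
  refine ⟨k + j, Cascade.ext ?_ ?_⟩
  · funext x
    rw [add_assoc, pow_add c k, pow_add c k, mul_left, mul_left, pow_left_of_act_eq c (hfix x),
      pow_left_of_act_eq c (hfix x), hj]
  · rw [pow_right, pow_right, add_assoc, pow_add_eq_of_pow_succ_eq hk,
      pow_add_eq_of_pow_succ_eq hk]

end Cascade

/-- The action of a monoid obtained by pulling back an action along a homomorphism. -/
def RightAction.comap {N N' X : Type u} [Monoid N] [Monoid N'] (ρ : RightAction N X)
    (g : N' →* N) : RightAction N' X where
  act x n := ρ.act x (g n)
  act_one x := by rw [map_one, ρ.act_one]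
  act_mul x m n := by rw [map_mul, ρ.act_mul]

/-- The homomorphism of semidirect products induced by a homomorphism of acting monoids. -/
def Cascade.comapHom (P : Type u) {N N' X : Type u} [Monoid P] [Monoid N] [Monoid N']
    (ρ : RightAction N X) (g : N' →* N) : Cascade P (ρ.comap g) →* Cascade P ρ where
  toFun c := ⟨c.left, g c.right⟩
  map_one' := Cascade.ext rfl (map_one g)
  map_mul' c d := Cascade.ext rfl (map_mul g c.right d.right)

/-- The trivial action. -/
def RightAction.trivial (N X : Type u) [Monoid N] : RightAction N X where
  act x _ := x
  act_one _ := rfl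
  act_mul _ _ _ := rfl

/-- The action of `P ^ X ⋊ B` on `Z × X` defined by actions of `P` on `Z` and of `B` on `X`. -/
def RightAction.cascade {P B Z X : Type u} [Monoid P] [Monoid B] (σ : RightAction P Z)
    (ρ : RightAction B X) : RightAction (Cascade P ρ) (Z × X) where
  act z c := (σ.act z.1 (c.left z.2), ρ.act z.2 c.right)
  act_one z := by simp [σ.act_one, ρ.act_one]
  act_mul z c d := by simp [σ.act_mul, ρ.act_mul]

/-- One direction of the associativity `(Q ^ Z ⋊ N) ^ X ⋊ B ≅ Q ^ (Z × X) ⋊ (N ^ X ⋊ B)`. -/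
def Cascade.assocHom (Q : Type u) {N B Z X : Type u} [Monoid Q] [Monoid N] [Monoid B]
    (σ : RightAction N Z) (ρ : RightAction B X) :
    Cascade (Cascade Q σ) ρ →* Cascade Q (σ.cascade ρ) where
  toFun c := ⟨fun z => (c.left z.2).left z.1, ⟨fun x => (c.left x).right, c.right⟩⟩
  map_one' := rfl
  map_mul' _ _ := rfl

theorem Cascade.assocHom_injective (Q : Type u) {N B Z X : Type u} [Monoid Q] [Monoid N]
    [Monoid B] (σ : RightAction N Z) (ρ : RightAction B X) :
    Function.Injective (Cascade.assocHom Q σ ρ) := by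
  intro c d h
  have hl := congrArg Cascade.left h
  have hr := congrArg Cascade.right h
  refine Cascade.ext (funext fun x => Cascade.ext (funext fun z => congrFun hl (z, x)) ?_)
    (congrArg Cascade.right hr :)
  exact congrFun (congrArg Cascade.left hr) x

/-- The homomorphism `P ^ X ⋊ N → Q ^ X ⋊ N` induced by a homomorphism `P → Q`. -/
def Cascade.mapLeft {P Q N X : Type u} [Monoid P] [Monoid Q] [Monoid N] (f : P →* Q)
    (ρ : RightAction N X) : Cascade P ρ →* Cascade Q ρ where
  toFun c := ⟨fun x => f (c.left x), c.right⟩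
  map_one' := Cascade.ext (funext fun _ => map_one f) rfl
  map_mul' _ _ := Cascade.ext (funext fun _ => map_mul f _ _) rfl

theorem Cascade.mapLeft_injective {P Q N X : Type u} [Monoid P] [Monoid Q] [Monoid N]
    {f : P →* Q} (hf : Function.Injective f) (ρ : RightAction N X) :
    Function.Injective (Cascade.mapLeft f ρ) := fun _ _ h =>
  Cascade.ext (funext fun x => hf (congrFun (congrArg Cascade.left h) x))
    (congrArg Cascade.right h :)

/-! ## Monoids that embed in iterated semidirect products -/

/-- A monoid at level `n + 1` embeds in `P ^ X ⋊ (G ^ Y ⋊ A)` where `P` is at level `n`, `G` is a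
finite group and `A` is a finite aperiodic monoid; level `0` consists of the finite aperiodic
monoids. -/
def CascadeLE : ℕ → (M : Type u) → [Monoid M] → Prop
  | 0, M, _ => Finite M ∧ PowersStabilize M
  | n + 1, M, _ => ∃ (P : Type u) (_ : Monoid P) (G : Type u) (_ : Group G) (A : Type u)
      (_ : Monoid A) (Y X : Type u) (σ : RightAction A Y) (ρ : RightAction (Cascade G σ) X),
      CascadeLE n P ∧ Finite G ∧ Finite A ∧ PowersStabilize A ∧ Finite Y ∧ Finite X ∧
      ∃ f : M →* Cascade P ρ, Function.Injective f

theorem CascadeLE.succ {n : ℕ} {M : Type u} [Monoid M] (h : CascadeLE n M) :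
    CascadeLE (n + 1) M := by
  refine ⟨M, inferInstance, PUnit, inferInstance, PUnit, inferInstance, PUnit, PUnit,
    .trivial _ _, .trivial _ _, h, inferInstance, inferInstance, fun _ => ⟨0, rfl⟩, inferInstance,
    inferInstance, ⟨⟨fun m => ⟨fun _ => m, 1⟩, rfl⟩, fun _ _ => rfl⟩, ?_⟩
  intro a b hab
  exact congrFun (congrArg Cascade.left hab) PUnit.unit

theorem CascadeLE.mono {m n : ℕ} (hmn : m ≤ n) {M : Type u} [Monoid M] (h : CascadeLE m M) :
    CascadeLE n M := by
  induction n, hmn using Nat.le_induction with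
  | base => exact h
  | succ n _ ih => exact ih.succ

/-- Reassociating moves `B` inward to the aperiodic factor: `Q ^ (Z × X) ⋊ (G ^ (Y × X) ⋊ (A ^ X ⋊
B))`. -/
theorem CascadeLE.cascade {n : ℕ} {P : Type u} [Monoid P] (hP : CascadeLE n P) {B X : Type u}
    [Monoid B] [Finite B] (hB : PowersStabilize B) [Finite X] (ρ : RightAction B X) :
    CascadeLE n (Cascade P ρ) := by
  cases n with
  | zero =>
    obtain ⟨hfin, hP⟩ := hP
    exact ⟨inferInstance, Cascade.powersStabilize hP hB⟩
  | succ n =>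
    obtain ⟨Q, _, G, _, A, _, Y, Z, σ, τ, hQ, _, _, hA, _, _, f, hf⟩ := hP
    let i := Cascade.assocHom G σ ρ
    let g : Cascade (Cascade Q τ) ρ →*
        Cascade Q (N := Cascade G (σ.cascade ρ)) (X := Z × X)
          { act := fun z c => (τ.act z.1 ⟨fun y => c.left (y, z.2), c.right.left z.2⟩,
              ρ.act z.2 c.right.right)
            act_one := fun z => Prod.ext (τ.act_one z.1) (ρ.act_one z.2)
            act_mul := fun z c d => Prod.ext
              (τ.act_mul z.1 ⟨fun y => c.left (y, z.2), c.right.left z.2⟩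
                ⟨fun y => d.left (y, ρ.act z.2 c.right.right),
                  d.right.left (ρ.act z.2 c.right.right)⟩)
              (ρ.act_mul z.2 _ _) } :=
      { toFun := fun c => ⟨fun z => (c.left z.2).left z.1, i ⟨fun x => (c.left x).right, c.right⟩⟩
        map_one' := rfl
        map_mul' := fun _ _ => rfl }
    have hg : Function.Injective g := by
      intro c d h
      have hr := Cascade.assocHom_injective G σ ρ (congrArg Cascade.right h :)
      refine Cascade.assocHom_injective Q τ ρ (Cascade.ext ?_ hr)
      exact (congrArg Cascade.left h :)
    exact ⟨Q, inferInstance, G, inferInstance, Cascade A ρ, inferInstance, Y × X, Z × X, _, _, hQ,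
      inferInstance, inferInstance, Cascade.powersStabilize hA hB, inferInstance, inferInstance,
      g.comp (Cascade.mapLeft f ρ), hg.comp (Cascade.mapLeft_injective hf ρ)⟩

/-! ## Iterated wreath products -/

/-- The action of `A` with a new identity on `A¹`. -/
def OneAdjoined.withOneAction (A : Type u) [Semigroup A] :
    RightAction (WithOne A) (OneAdjoined A) where
  act x a := ⟨x.1 * a, by
    induction a with
    | one => simpa using x.2
    | coe a => exact (x.act a).2⟩
  act_one x := Subtype.ext (mul_one x.1)
  act_mul x a b := Subtype.ext (mul_assoc x.1 a b).symm

theorem OneAdjoined.act_one {G : Type u} [Monoid G] (x : OneAdjoined G) : x.act 1 = x := by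
  obtain ⟨x, hx⟩ := x
  apply Subtype.ext
  induction x with
  -- A monoid gets no new identity, which is what makes the action of `G` on `G¹` unitary.
  | one => exact absurd ⟨1, fun t => ⟨one_mul t, mul_one t⟩⟩ (hx rfl)
  | coe a => exact congrArg WithOne.coe (mul_one a)

instance (A : Type u) [Semigroup A] [Finite A] : Finite (OneAdjoined A) :=
  haveI : Finite (WithOne A) := inferInstanceAs (Finite (Option A))
  inferInstanceAs (Finite {x : WithOne A // x = 1 → ¬ HasIdentity A})

theorem IteratedWreath.exists_cascadeLE {n : ℕ} {W : Type u} [sW : Semigroup W]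
    (h : IteratedWreath n W sW) :
    ∃ (M : Type u) (_ : Monoid M) (f : W →ₙ* M), CascadeLE n M ∧ Function.Injective f := by
  induction h with
  | base A hA =>
    exact ⟨WithOne A, inferInstance, WithOne.coeMulHom,
      ⟨inferInstanceAs (Finite (Option A)), hA.powersStabilize_withOne⟩, WithOne.coe_injective⟩
  | @step n W sW hW G _ _ A _ _ hA ih =>
    obtain ⟨P, _, f, hP, hf⟩ := ih
    let σ := OneAdjoined.withOneAction A
    let ρ : RightAction (Cascade G σ) (OneAdjoined G × OneAdjoined A) :=
      { act := fun z c => (z.1.act (c.left z.2), σ.act z.2 c.right)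
        act_one := fun z => Prod.ext z.1.act_one (σ.act_one z.2)
        act_mul := fun z c d => Prod.ext (z.1.act_mul _ _) (σ.act_mul z.2 _ _) }
    let g : Wreath (Wreath W G) A →ₙ* Cascade P ρ :=
      { toFun := fun w => ⟨fun z => f ((w.left z.2).left z.1),
          ⟨fun x => (w.left x).right, (w.right : WithOne A)⟩⟩
        map_mul' := fun v w => Cascade.ext (funext fun z => map_mul f _ _) rfl }
    refine ⟨Cascade P ρ, inferInstance, g, ⟨P, inferInstance, G, inferInstance, WithOne A,
      inferInstance, _, _, σ, ρ, hP, inferInstance, inferInstanceAs (Finite (Option A)),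
      hA.powersStabilize_withOne, inferInstance, inferInstance, MonoidHom.id _,
      Function.injective_id⟩, ?_⟩
    intro v w h
    have hl := congrArg Cascade.left h
    have hr := congrArg Cascade.right h
    refine Wreath.ext (funext fun x => Wreath.ext (funext fun z => hf (congrFun hl (z, x))) ?_)
      (WithOne.coe_injective (congrArg Cascade.right hr))
    exact congrFun (congrArg Cascade.left hr) x

/-! ## Monoids with at most one idempotent in each `R`-class -/

/-- Any two `R`-equivalent idempotents are equal. -/
def UniqueRIdempotents (M : Type u) [Semigroup M] : Prop :=
  ∀ e f : M, e * e = e → f * f = f → e * f = f → f * e = e → e = f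

theorem IsER.uniqueRIdempotents {M : Type u} [Semigroup M] (h : IsER M) :
    UniqueRIdempotents M := by
  intro e f he hf hef hfe
  let e' : Subsemigroup.closure {e : M | IsIdempotentElem e} :=
    ⟨e, Subsemigroup.subset_closure he⟩
  let f' : Subsemigroup.closure {e : M | IsIdempotentElem e} :=
    ⟨f, Subsemigroup.subset_closure hf⟩
  exact congrArg Subtype.val (h e' f' f' e' (Subtype.ext hef) (Subtype.ext hfe))

/-- The `A`-components agree by hypothesis. Cancelling in `G`, an idempotent `f` has `f.left = 1` on
the image of `f.right`, so `e * f = f` forces equal left parts. -/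
theorem Cascade.uniqueRIdempotents {G A Y : Type u} [Group G] [Monoid A] (σ : RightAction A Y)
    (A' : Submonoid A) (hA : UniqueRIdempotents A') :
    UniqueRIdempotents (A'.comap (Cascade.rightHom G σ)) := by
  rintro ⟨e, he'⟩ ⟨f, hf'⟩ he hf hef hfe
  replace he := congrArg Subtype.val he
  replace hf := congrArg Subtype.val hf
  replace hef := congrArg Subtype.val hef
  replace hfe := congrArg Subtype.val hfe
  simp only [Submonoid.coe_mul] at he hf hef hfe
  have hr : e.right = f.right :=
    congrArg Subtype.val (hA ⟨e.right, he'⟩ ⟨f.right, hf'⟩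
      (Subtype.ext (congrArg Cascade.right he)) (Subtype.ext (congrArg Cascade.right hf))
      (Subtype.ext (congrArg Cascade.right hef)) (Subtype.ext (congrArg Cascade.right hfe)))
  refine Subtype.ext (Cascade.ext (funext fun y => ?_) hr)
  have h1 := congrFun (congrArg Cascade.left hf) y
  have h2 := congrFun (congrArg Cascade.left hef) y
  rw [Cascade.mul_left] at h1 h2
  rw [← h2, hr, mul_eq_left.mp h1, mul_one]

/-- The element `x` is regular and `x * m` is `R`-equivalent to `x`. -/
def StaysInRegularRClass {M : Type u} [Monoid M] (x m : M) : Prop :=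
  (∃ x', x * x' * x = x) ∧ ∃ w, x * m * w = x

/-- Here `u` fixes `x` and sends `y` to `x`, while `v` sends `x` to `y`. Then `u * e` and `u * (e *
v)` are `R`-equivalent idempotents, hence equal; applying them to `x` gives `x` and `y`. -/
theorem UniqueRIdempotents.eq_of_mul_eq {M : Type u} [Monoid M] (hM : UniqueRIdempotents M)
    {x y m : M} (hx : StaysInRegularRClass x m) (hy : StaysInRegularRClass y m)
    (h : x * m = y * m) : x = y := by
  obtain ⟨⟨x', hx'⟩, w, hw⟩ := hx
  obtain ⟨-, w', hw'⟩ := hy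
  set u := m * w with hu
  set v := m * w' with hv
  set e := x' * x with he
  have hxu : x * u = x := by rw [hu, ← mul_assoc, hw]
  have hxv : x * v = y := by rw [hv, ← mul_assoc, h, hw']
  have hyu : y * u = x := by rw [hu, ← mul_assoc, ← h, hw]
  have hxe : x * e = x := by rw [he, ← mul_assoc, hx']
  have hee : e * e = e := by rw [he, mul_assoc, ← he, hxe]
  have heu : e * u = e := by rw [he, mul_assoc, hxu]
  have hevu : e * v * u = e := by rw [he, mul_assoc x', hxv, mul_assoc, hyu]
  have key : u * e = u * (e * v) := by
    apply hM
    · rw [mul_assoc, ← mul_assoc e, heu, hee]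
    · rw [mul_assoc, ← mul_assoc (e * v), hevu, ← mul_assoc e, hee]
    · rw [mul_assoc, ← mul_assoc e, heu, ← mul_assoc e, hee]
    · rw [mul_assoc, ← mul_assoc (e * v), hevu, hee]
  calc x = x * (u * e) := by rw [← mul_assoc, hxu, hxe]
    _ = x * (u * (e * v)) := by rw [key]
    _ = y := by rw [← mul_assoc, hxu, ← mul_assoc, hxe, hxv]

theorem UniqueRIdempotents.exists_perm {M : Type u} [Monoid M] [Finite M]
    (hM : UniqueRIdempotents M) (m : M) :
    ∃ σ : Equiv.Perm M, ∀ x, StaysInRegularRClass x m → σ (x * m) = x := by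
  classical
  have := Fintype.ofFinite M
  obtain ⟨g, hg⟩ := Set.MapsTo.exists_equiv_extend_of_card_eq (α := M) (t := Finset.univ) rfl
    (s := {x | StaysInRegularRClass x m}) (f := (· * m))
    (fun _ _ => Finset.mem_coe.2 (Finset.mem_univ _)) fun x hx y hy h => hM.eq_of_mul_eq hx hy h
  -- The inverse is taken because permutations compose on the left while `M` acts on the right.
  refine ⟨(g.trans (Equiv.subtypeUnivEquiv Finset.mem_univ)).symm, fun x hx => ?_⟩
  rw [Equiv.symm_apply_eq]
  exact (hg x hx).symm

/-- Relates `m` to the permutations whose inverses extend the partial injection `x ↦ x * m` of the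
regular `R`-classes. -/
def UniqueRIdempotents.toPerm {M : Type u} [Monoid M] [Finite M] (hM : UniqueRIdempotents M) :
    RelMorphism M (Equiv.Perm M) where
  graph :=
    { carrier := {p | ∀ x, StaysInRegularRClass x p.1 → p.2 (x * p.1) = x}
      one_mem' := fun x _ => mul_one x
      mul_mem' := by
        rintro ⟨m, σ⟩ ⟨m', σ'⟩ h h' x ⟨⟨x', hx'⟩, w, hw⟩
        replace hw : x * m * m' * w = x := (congrArg (· * w) (mul_assoc x m m')).trans hw
        have h1 : StaysInRegularRClass x m := ⟨⟨x', hx'⟩, m' * w, by rw [← mul_assoc, hw]⟩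
        have h2 : StaysInRegularRClass (x * m) m' :=
          ⟨⟨m' * w * x', by simp only [← mul_assoc, hw, hx']⟩, w * m, by rw [← mul_assoc, hw]⟩
        change σ (σ' (x * (m * m'))) = x
        rw [← mul_assoc]
        exact (congrArg σ (h' _ h2)).trans (h x h1) }
  total := hM.exists_perm

/-- The submonoid of elements related to `1`. -/
def RelMorphism.preimageOne {S T : Type u} [Monoid S] [Monoid T] (φ : RelMorphism S T) :
    Submonoid S where
  carrier := {s | φ.Rel s 1}
  one_mem' := φ.graph.one_mem
  mul_mem' {a b} ha hb := by
    have h := φ.graph.mul_mem ha hb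
    rwa [Prod.mk_mul_mk, mul_one] at h

/-- An element `m` related to `1` fixes every regular `x` with `x * m` in the `R`-class of `x`. The
idempotent power of `m` is such an `x`. -/
theorem UniqueRIdempotents.powersStabilize_preimageOne {M : Type u} [Monoid M] [Finite M]
    (hM : UniqueRIdempotents M) : PowersStabilize hM.toPerm.preimageOne := by
  rintro ⟨m, hm⟩
  obtain ⟨k, hk, hper⟩ := exists_period m
  have hidem : m ^ k * m ^ k = m ^ k := by
    rw [← pow_add]
    simpa only [mul_one] using hper k 1 le_rfl
  refine ⟨k, Subtype.ext ?_⟩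
  obtain ⟨j, rfl⟩ := Nat.exists_eq_succ_of_ne_zero hk.ne'
  have h := hm (m ^ (j + 1)) ⟨⟨1, by rw [mul_one, hidem]⟩, m ^ j, by
    change m ^ (j + 1) * m * m ^ j = m ^ (j + 1)
    rw [mul_assoc, ← pow_succ', hidem]⟩
  simpa [pow_succ] using h

/-! ## Loopable elements -/

theorem IsLoopable.exists_isAperiodicElement {n : ℕ} {S : Type u} [Monoid S] {s : S}
    (hs : IsLoopable n S s) {M : Type u} [Monoid M] (hM : CascadeLE n M) (φ : RelMorphism S M) :
    ∃ m : M, IsAperiodicElement m ∧ φ.Rel s m := by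
  induction n generalizing S M with
  | zero =>
    obtain ⟨m, hm⟩ := φ.total s
    exact ⟨m, isAperiodicElement_iff.2 (hM.2 m), hm⟩
  | succ n ih =>
    obtain ⟨P, _, G, _, A, _, Y, X, σ, ρ, hP, _, _, hA, _, _, f, hf⟩ := hM
    obtain ⟨T, hT, k, rfl, hk⟩ := hs
    let toA : M →* A := (Cascade.rightHom G σ).comp ((Cascade.rightHom P ρ).comp f)
    let φA : RelMorphism S A :=
      { graph := φ.graph.map ((MonoidHom.id S).prodMap toA)
        total := fun s => by
          obtain ⟨m, hm⟩ := φ.total s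
          exact ⟨toA m, (s, m), hm, rfl⟩ }
    obtain ⟨A', hER, hA'⟩ := hT A hA.isAperiodicSemigroup φA
    let N := A'.comap (Cascade.rightHom G σ)
    have hN : UniqueRIdempotents N := Cascade.uniqueRIdempotents σ A' hER.uniqueRIdempotents
    have hTN : ∀ t : T, ∃ m : M, φ.Rel t m ∧ (f m).right ∈ N := by
      rintro ⟨t, ht⟩
      obtain ⟨a, ha, ⟨_, m⟩, hm, h⟩ := hA' t ht
      obtain ⟨rfl, rfl⟩ := Prod.mk.inj h
      exact ⟨m, hm, ha⟩
    -- The composite of `T → N` with `N → Equiv.Perm N`, to which the Type II condition is applied.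
    let φH : RelMorphism T (Equiv.Perm N) :=
      { graph :=
          { carrier := {p | ∃ (m : M) (n : N), φ.Rel p.1 m ∧ (f m).right = n ∧ hN.toPerm.Rel n p.2}
            one_mem' := ⟨1, 1, φ.graph.one_mem, by rw [map_one]; rfl, hN.toPerm.graph.one_mem⟩
            mul_mem' := by
              rintro ⟨_, _⟩ ⟨_, _⟩ ⟨m, n, hm, hmn, hn⟩ ⟨m', n', hm', hmn', hn'⟩
              exact ⟨m * m', n * n', φ.graph.mul_mem hm hm',
                by rw [map_mul, Cascade.mul_right, hmn, hmn']; rfl,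
                hN.toPerm.graph.mul_mem hn hn'⟩ }
        total := fun t => by
          obtain ⟨m, hm, hmN⟩ := hTN t
          obtain ⟨h, hh⟩ := hN.toPerm.total ⟨_, hmN⟩
          exact ⟨h, m, ⟨_, hmN⟩, hm, rfl, hh⟩ }
    let B := hN.toPerm.preimageOne
    let ι := Cascade.comapHom P ρ (N.subtype.comp B.subtype)
    let φK : RelMorphism (typeII T) (Cascade P (ρ.comap (N.subtype.comp B.subtype))) :=
      { graph :=
          { carrier := {p | ∃ m : M, φ.Rel (p.1 : T) m ∧ f m = ι p.2}
            one_mem' := ⟨1, φ.graph.one_mem, by rw [Prod.snd_one, map_one, map_one]⟩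
            mul_mem' := by
              rintro ⟨_, _⟩ ⟨_, _⟩ ⟨m, hm, hmc⟩ ⟨m', hm', hmc'⟩
              exact ⟨m * m', φ.graph.mul_mem hm hm',
                by rw [map_mul, Prod.mk_mul_mk, map_mul, hmc, hmc']⟩ }
        total := fun t => by
          -- Being related to `1` under `φH` puts the middle coordinate of some `f m` in `B`.
          obtain ⟨m, n, hm, hmn, hn⟩ := t.2 (Equiv.Perm N) φH
          exact ⟨⟨(f m).left, ⟨n, hn⟩⟩, m, hm, Cascade.ext rfl hmn⟩ }
    obtain ⟨c, hc, m, hm, hmc⟩ := ih hk (hP.cascade hN.powersStabilize_preimageOne _) φK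
    refine ⟨m, ?_, hm⟩
    obtain ⟨j, hj⟩ := isAperiodicElement_iff.1 hc
    refine isAperiodicElement_iff.2 ⟨j, hf ?_⟩
    rw [map_pow, map_pow, hmc, ← map_pow, ← map_pow, hj]

/-- The division is composed with `φ` to reach `M`. Stability of powers in `M` returns to `K` by
injectivity of `g`, then to `T` along `d`. -/
theorem ComplexityLE.exists_isAperiodicElement_of_isLoopable {n : ℕ} {S T : Type u} [Monoid S]
    [Monoid T] {s : S} (hs : IsLoopable n S s) (hT : ComplexityLE n T) (φ : RelMorphism S T) :
    ∃ t : T, IsAperiodicElement t ∧ φ.Rel s t := by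
  obtain ⟨-, m, hmn, W, _, hW, K, d, hd⟩ := hT
  obtain ⟨M, _, g, hM, hg⟩ := hW.exists_cascadeLE
  let φM : RelMorphism S M :=
    { graph :=
        -- The pair `1` is adjoined because `K` is only a subsemigroup and `g` need not hit the
        -- identity of `M`.
        { carrier := {p | p = 1 ∨ ∃ k : K, φ.Rel p.1 (d k) ∧ g k = p.2}
          one_mem' := Or.inl rfl
          mul_mem' := by
            rintro p q (rfl | ⟨k, hk, hkp⟩) (rfl | ⟨l, hl, hlq⟩)
            · exact Or.inl (mul_one 1)
            · exact Or.inr ⟨l, by rwa [one_mul], by rwa [one_mul]⟩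
            · exact Or.inr ⟨k, by rwa [mul_one], by rwa [mul_one]⟩
            · refine Or.inr ⟨k * l, ?_, ?_⟩
              · rw [map_mul]
                exact φ.graph.mul_mem hk hl
              · rw [MulMemClass.coe_mul, map_mul, hkp, hlq, Prod.snd_mul] }
      total := fun s => by
        obtain ⟨t, ht⟩ := φ.total s
        obtain ⟨k, rfl⟩ := hd t
        exact ⟨g k, Or.inr ⟨k, ht, rfl⟩⟩ }
  obtain ⟨x, hx, hsx⟩ := hs.exists_isAperiodicElement (hM.mono hmn) φM
  rcases hsx with h | ⟨k, hk, rfl⟩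
  · obtain ⟨rfl, -⟩ := Prod.mk.inj h
    exact ⟨1, isAperiodicElement_iff.2 ⟨0, by simp⟩, φ.graph.one_mem⟩
  · refine ⟨d k, ?_, hk⟩
    have hpow : ∀ i : ℕ, ∃ l : K, g l = g k ^ (i + 1) ∧ d l = d k ^ (i + 1) := by
      intro i
      induction i with
      | zero => exact ⟨k, (pow_one _).symm, (pow_one _).symm⟩
      | succ i ih =>
        obtain ⟨l, hl, hl'⟩ := ih
        exact ⟨l * k, by rw [MulMemClass.coe_mul, map_mul, hl, ← pow_succ],
          by rw [map_mul, hl', ← pow_succ]⟩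
    obtain ⟨j, hj⟩ := isAperiodicElement_iff.1 hx
    obtain ⟨l, hl, hl'⟩ := hpow j
    obtain ⟨l', hl₁, hl₁'⟩ := hpow (j + 1)
    have hll' : l' = l := Subtype.ext (hg (by rw [hl₁, hl, pow_succ, hj, ← pow_succ, hj]))
    exact isAperiodicElement_iff.2 ⟨j + 1, by rw [← hl₁', ← hl', hll']⟩

end KrohnRhodes

theorem mainTheorem7 {S : Type*} [Monoid S] (n : ℕ) (s : S)
    (hs : KrohnRhodes.IsLoopable n S s) :
    KrohnRhodes.IsComplexityAperiodic n s :=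
  fun _ _ hT φ => hT.exists_isAperiodicElement_of_isLoopable hs φ
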